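/- Let $\mathcal A$ be an abelian category (with small $\operatorname{Ext}$-groups) and let $F$ be an additive subbifunctor of $\operatorname{Ext}^1_{\mathcal A}(-,-)$, that is, a family of subgroups $F(Z,X)\subseteq\operatorname{Ext}^1_{\mathcal A}(Z,X)$ stable under pushouts and pullbacks. A short exact sequence $0\to X\to Y\to Z\to 0$ is $F$-exact if its class lies in $F(Z,X)$; an object $P$ is $F$-projective if $\operatorname{Hom}(P,-)$ is exact on $F$-exact sequences, and $\mathcal P(F)$ is the full subcategory of $F$-projective objects. Suppose that $F$ has enough projectives: for each object $C$ there is an $F$-exact sequence $0\to X\to P\to C\to 0$ with $P\in\mathcal P(F)$. A complex $X^\bullet$ is $F$-acyclic if the sequences $0\to\operatorname{Im}d^{i-1}\to X^i\to\operatorname{Im}d^i\to0$ are $F$-exact for all $i$. For $*\in\{-,b\}$, let $D_F^*(\mathcal A)$ be the Verdier quotient of the homotopy category $K^*(\mathcal A)$ (of bounded above, respectively bounded, complexes) by the $F$-acyclic complexes in it. Let $K^{-,Fb}(\mathcal P(F))$ be the full subcategory of $K^-(\mathcal P(F))$ of those $X^\bullet$ for which there is $n\in\mathbb Z$ with $H^i(\operatorname{Hom}_{\mathcal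 A}(P,X^\bullet))=0$ for all $i\le n$ and all $P\in\mathcal P(F)$. Then the natural functor $K^-(\mathcal P(F))\to K^-(\mathcal A)\to D_F^-(\mathcal A)$ is a triangle equivalence $$K^-(\mathcal P(F))\simeq D_F^-(\mathcal A),$$ and it induces a triangle equivalence $$K^{-,Fb}(\mathcal P(F))\simeq D_F^b(\mathcal A),$$ that is, there is a triangle equivalence $E:K^{-,Fb}(\mathcal P(F))\to D_F^b(\mathcal A)$ whose composition with the functor $D_F^b(\mathcal A)\to D_F^-(\mathcal A)$ induced by the inclusion $K^b(\mathcal A)\subseteq K^-(\mathcal A)$ is isomorphic, compatibly with the shifts, to the restriction of $K^-(\mathcal P(F))\to D_F^-(\mathcal A)$ to $K^{-,Fb}(\mathcal P(F))$. -/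

import Mathlib

open CategoryTheory Limits Pretriangulated Opposite ZeroObject

universe w v u

/-! ### Bounded above and bounded homotopy categories of an additive category -/

namespace HomotopyCategory

section

variable (C : Type*) [Category* C] [Preadditive C]

/-- The objects of `K(C)` whose underlying cochain complex is bounded above
(not closed under isomorphisms in `K(C)`). -/
def minus : ObjectProperty (HomotopyCategory C (.up ℤ)) :=
  fun X => ∃ n : ℤ, CochainComplex.IsStrictlyLE X.as n

/-- The objects of `K(C)` whose underlying cochain complex is bounded. -/
def bounded : ObjectProperty (HomotopyCategory C (.up ℤ)) :=
  fun X => (∃ n : ℤ, CochainComplex.IsStrictlyGE X.as n) ∧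
    ∃ n : ℤ, CochainComplex.IsStrictlyLE X.as n

/-- The homotopy category `K⁻(C)` of bounded above cochain complexes. -/
abbrev Minus := (minus C).FullSubcategory

/-- The homotopy category `Kᵇ(C)` of bounded cochain complexes. -/
abbrev Bounded := (bounded C).FullSubcategory

variable {C}

instance : (minus C).IsStableUnderShift ℤ where
  isStableUnderShiftBy n :=
    { le_shift := fun K hK => by
        obtain ⟨K : CochainComplex _ _, rfl⟩ := K.quotient_obj_surjective
        rw [ObjectProperty.prop_shift_iff, shift_quotient_obj]
        obtain ⟨q, hq⟩ := hK
        have : K.IsStrictlyLE q := hq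
        exact ⟨q - n, K.isStrictlyLE_shift q n (q - n) (by lia)⟩ }

instance : (bounded C).IsStableUnderShift ℤ where
  isStableUnderShiftBy n :=
    { le_shift := fun K hK => by
        obtain ⟨K : CochainComplex _ _, rfl⟩ := K.quotient_obj_surjective
        rw [ObjectProperty.prop_shift_iff, shift_quotient_obj]
        obtain ⟨⟨p, hp⟩, ⟨q, hq⟩⟩ := hK
        have : K.IsStrictlyGE p := hp
        have : K.IsStrictlyLE q := hq
        exact ⟨⟨p - n, K.isStrictlyGE_shift p n (p - n) (by lia)⟩,
          ⟨q - n, K.isStrictlyLE_shift q n (q - n) (by lia)⟩⟩ }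

lemma minus_of_bounded (X : Bounded C) : minus C ((bounded C).ι.obj X) := X.property.2

/-- The inclusion `Kᵇ(C) ⥤ K⁻(C)`. -/
def boundedToMinus (C : Type*) [Category* C] [Preadditive C] : Bounded C ⥤ Minus C :=
  (minus C).lift (bounded C).ι minus_of_bounded

noncomputable instance : (boundedToMinus C).CommShift ℤ :=
  inferInstanceAs (((minus C).lift (bounded C).ι minus_of_bounded).CommShift ℤ)

lemma isTriangulated_of_mappingCone [HasZeroObject C] [HasBinaryBiproducts C]
    (P : ObjectProperty (HomotopyCategory C (.up ℤ))) [P.IsStableUnderShift ℤ]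
    (h0 : P ((quotient C (.up ℤ)).obj 0))
    (hc : ∀ (K L : CochainComplex C ℤ) (f : K ⟶ L), P ((quotient C (.up ℤ)).obj K) →
      P ((quotient C (.up ℤ)).obj L) →
      P ((quotient C (.up ℤ)).obj (CochainComplex.mappingCone f))) :
    P.IsTriangulated := by
  have : P.ContainsZero := ⟨⟨_, Functor.map_isZero _ (isZero_zero _), h0⟩⟩
  have : P.IsTriangulatedClosed₃ :=
    { ext₃' := fun T hT h₁ h₂ => by
        obtain ⟨f : T.obj₁.as ⟶ T.obj₂.as, hf⟩ := (quotient _ _).map_surjective T.mor₁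
        refine ⟨_, hc _ _ f h₁ h₂,
          ⟨Triangle.π₃.mapIso (isoTriangleOfIso₁₂ T _ hT (mappingCone_triangleh_distinguished f)
            (Iso.refl _) (Iso.refl _) ?_)⟩⟩
        rw [← hf]
        exact (Category.comp_id _).trans (Category.id_comp _).symm }
  have : P.IsTriangulatedClosed₂ := .of_isTriangulatedClosed₃
  constructor

end

section

variable {C : Type*} [Category* C] [Preadditive C] [HasBinaryBiproducts C]

lemma isStrictlyLE_mappingCone {K L : CochainComplex C ℤ} (f : K ⟶ L) (n₁ n₂ : ℤ)
    [K.IsStrictlyLE n₁] [L.IsStrictlyLE n₂] :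
    (CochainComplex.mappingCone f).IsStrictlyLE (max n₁ n₂) := by
  rw [CochainComplex.isStrictlyLE_iff]
  intro i hi
  simp only [CochainComplex.mappingCone.isZero_X_iff]
  have h₁ := le_max_left n₁ n₂
  have h₂ := le_max_right n₁ n₂
  exact ⟨K.isZero_of_isStrictlyLE n₁ _, L.isZero_of_isStrictlyLE n₂ _⟩

instance [HasZeroObject C] : (minus C).IsTriangulated := by
  apply isTriangulated_of_mappingCone
  · exact ⟨0, inferInstanceAs (CochainComplex.IsStrictlyLE (0 : CochainComplex C ℤ) 0)⟩
  · rintro K L f ⟨n₁, h₁⟩ ⟨n₂, h₂⟩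
    have : K.IsStrictlyLE n₁ := h₁
    have : L.IsStrictlyLE n₂ := h₂
    exact ⟨_, isStrictlyLE_mappingCone f n₁ n₂⟩

instance [HasZeroObject C] : (bounded C).IsTriangulated := by
  apply isTriangulated_of_mappingCone
  · exact ⟨⟨0, inferInstanceAs (CochainComplex.IsStrictlyGE (0 : CochainComplex C ℤ) 0)⟩,
      ⟨0, inferInstanceAs (CochainComplex.IsStrictlyLE (0 : CochainComplex C ℤ) 0)⟩⟩
  · rintro K L f ⟨⟨m₁, g₁⟩, ⟨n₁, h₁⟩⟩ ⟨⟨m₂, g₂⟩, ⟨n₂, h₂⟩⟩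
    have : K.IsStrictlyGE m₁ := g₁
    have : L.IsStrictlyGE m₂ := g₂
    have : K.IsStrictlyLE n₁ := h₁
    have : L.IsStrictlyLE n₂ := h₂
    exact ⟨⟨min (m₁ - 1) m₂, CochainComplex.isStrictlyGE_mappingCone f m₁ m₂ _
      (by simp) (by simp)⟩, ⟨_, isStrictlyLE_mappingCone f n₁ n₂⟩⟩

instance [HasZeroObject C] : (boundedToMinus C).IsTriangulated :=
  inferInstanceAs ((minus C).lift (bounded C).ι minus_of_bounded).IsTriangulated

end

end HomotopyCategory

namespace CategoryTheory.Functor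

variable {C D : Type*} [Category* C] [Category* D] [Preadditive C] [Preadditive D]
  (G : C ⥤ D) [G.Additive]

/-- The functor `K⁻(C) ⥤ K⁻(D)` induced by an additive functor `C ⥤ D`. -/
def mapHomotopyCategoryMinus :
    HomotopyCategory.Minus C ⥤ HomotopyCategory.Minus D :=
  (HomotopyCategory.minus D).lift
    ((HomotopyCategory.minus C).ι ⋙ G.mapHomotopyCategory (.up ℤ)) (by
      rintro ⟨X, n, hX⟩
      obtain ⟨K, rfl⟩ := HomotopyCategory.quotient_obj_surjective X
      have : CochainComplex.IsStrictlyLE K n := hX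
      exact ⟨n, inferInstanceAs (CochainComplex.IsStrictlyLE
        ((G.mapHomologicalComplex _).obj K) n)⟩)

noncomputable instance : G.mapHomotopyCategoryMinus.CommShift ℤ :=
  inferInstanceAs (((HomotopyCategory.minus D).lift
    ((HomotopyCategory.minus C).ι ⋙ G.mapHomotopyCategory (.up ℤ)) _).CommShift ℤ)

instance [HasZeroObject C] [HasBinaryBiproducts C] [HasZeroObject D] [HasBinaryBiproducts D] :
    G.mapHomotopyCategoryMinus.IsTriangulated :=
  inferInstanceAs ((HomotopyCategory.minus D).lift
    ((HomotopyCategory.minus C).ι ⋙ G.mapHomotopyCategory (.up ℤ)) _).IsTriangulated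

end CategoryTheory.Functor

/-! ### The complexes `Hom(P, K)` -/

namespace HomotopyCategory

variable {A : Type u} [Category.{v} A] [Abelian A]

/-- The complex of abelian groups `Hom(P, K)`. -/
noncomputable abbrev homComplex (P : A) (K : CochainComplex A ℤ) :
    CochainComplex AddCommGrpCat.{v} ℤ :=
  ((preadditiveCoyoneda.obj (op P)).mapHomologicalComplex (.up ℤ)).obj K

/-- The functor `Hom(P, -) : K(𝒜) ⥤ K(Ab)`. -/
noncomputable abbrev homFunctor (P : A) :
    HomotopyCategory A (.up ℤ) ⥤ HomotopyCategory AddCommGrpCat.{v} (.up ℤ) :=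
  (preadditiveCoyoneda.obj (op P)).mapHomotopyCategory (.up ℤ)

lemma exactAt_homComplex_iff (P : A) (K : CochainComplex A ℤ) (h i j : ℤ)
    (hi : h + 1 = i) (hj : i + 1 = j) :
    (homComplex P K).ExactAt i ↔
      ∀ f : P ⟶ K.X i, f ≫ K.d i j = 0 → ∃ g : P ⟶ K.X h, g ≫ K.d h i = f := by
  rw [HomologicalComplex.exactAt_iff' _ h i j (by simp; lia) (by simp; lia),
    ShortComplex.ab_exact_iff]
  rfl

end HomotopyCategory

/-! ### Additive subbifunctors of `Ext¹` -/

/-- An additive subbifunctor `F` of `Ext¹(-,-) : 𝒜ᵒᵖ × 𝒜 ⥤ Ab`: a family of subgroups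
`F(Z, X) ⊆ Ext¹(Z, X)` (for the Baer sum) stable under pushouts and pullbacks. -/
structure ExtSubbifunctor (A : Type u) [Category.{v} A] [Abelian A] [HasExt.{w} A] where
  /-- The subgroup `F(Z, X)` of `Ext¹(Z, X)`. -/
  obj (Z X : A) : AddSubgroup (Abelian.Ext.{w} Z X 1)
  pushout_mem {Z X X' : A} (f : X ⟶ X') (e : Abelian.Ext.{w} Z X 1) :
    e ∈ obj Z X → e.comp (Abelian.Ext.mk₀ f) (add_zero 1) ∈ obj Z X'
  pullback_mem {Z Z' X : A} (f : Z' ⟶ Z) (e : Abelian.Ext.{w} Z X 1) :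
    e ∈ obj Z X → (Abelian.Ext.mk₀ f).comp e (zero_add 1) ∈ obj Z' X

namespace ExtSubbifunctor

open HomotopyCategory

variable {A : Type u} [Category.{v} A] [Abelian A] [HasExt.{w} A] (F : ExtSubbifunctor.{w} A)

/-- `F`-exact sequences: short exact sequences `0 ⟶ X ⟶ Y ⟶ Z ⟶ 0` whose class
in `Ext¹(Z, X)` belongs to `F(Z, X)`. -/
def IsExact (S : ShortComplex A) : Prop :=
  ∃ h : S.ShortExact, h.extClass ∈ F.obj S.X₃ S.X₁

/-- `F`-projective objects: those `P` such that `Hom(P, -)` is exact on `F`-exact sequences.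
As `Hom(P, -)` is left exact, this means that `Hom(P, Y) → Hom(P, Z)` is surjective for
every `F`-exact sequence `0 ⟶ X ⟶ Y ⟶ Z ⟶ 0`. -/
def isProjective : ObjectProperty A :=
  fun P => ∀ S : ShortComplex A, F.IsExact S → ∀ f : P ⟶ S.X₃, ∃ g : P ⟶ S.X₂, g ≫ S.g = f

/-- The full subcategory `𝒫(F)` of `F`-projective objects. -/
abbrev Projectives := F.isProjective.FullSubcategory

/-- `F` has enough projectives: every object `C` is the right end of an `F`-exact sequence
`0 ⟶ X ⟶ P ⟶ C ⟶ 0` with `P` an `F`-projective object. -/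
class EnoughProjectives : Prop where
  exists_isExact (C : A) : ∃ (X P : A) (i : X ⟶ P) (p : P ⟶ C) (zero : i ≫ p = 0),
    F.isProjective P ∧ F.IsExact (ShortComplex.mk i p zero)

/-- For composable morphisms `f : X ⟶ Y`, `g : Y ⟶ Z` with `f ≫ g = 0`, the
sequence `Im f ⟶ Y ⟶ Im g`. -/
noncomputable abbrev imageSequence {X Y Z : A} (f : X ⟶ Y) (g : Y ⟶ Z) (zero : f ≫ g = 0) :
    ShortComplex A :=
  ShortComplex.mk (image.ι f) (factorThruImage g) (by
    rw [← cancel_epi (factorThruImage f), ← cancel_mono (image.ι g)]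
    simpa using zero)

/-- A cochain complex is `F`-acyclic if all sequences
`0 ⟶ Im dⁱ⁻¹ ⟶ Xⁱ ⟶ Im dⁱ ⟶ 0` are `F`-exact. -/
def Acyclic (K : CochainComplex A ℤ) : Prop :=
  ∀ (h i j : ℤ) (_ : h + 1 = i) (_ : i + 1 = j),
    F.IsExact (imageSequence (K.d h i) (K.d i j) (K.d_comp_d h i j))

/-- The class `𝒩` of objects of `K(𝒜)` that are `F`-acyclic complexes. -/
def acyclic : ObjectProperty (HomotopyCategory A (.up ℤ)) :=
  fun X => F.Acyclic X.as

variable {F} in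
lemma exists_epi_isProjective [F.EnoughProjectives] (C : A) :
    ∃ (P : A) (p : P ⟶ C), F.isProjective P ∧ Epi p := by
  obtain ⟨X, P, i, p, zero, hP, h, -⟩ := EnoughProjectives.exists_isExact (F := F) C
  exact ⟨P, p, hP, h.epi_g⟩

variable {F} in
lemma IsExact.of_lift [F.EnoughProjectives] {S : ShortComplex A} (hS : S.ShortExact)
    (h : ∀ P, F.isProjective P → ∀ f : P ⟶ S.X₃, ∃ g : P ⟶ S.X₂, g ≫ S.g = f) :
    F.IsExact S := by
  obtain ⟨X, P, i, p, zero, hP, hp, hmem⟩ := EnoughProjectives.exists_isExact (F := F) S.X₃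
  obtain ⟨g, hg⟩ := h P hP p
  have := hS.mono_f
  let l : X ⟶ S.X₁ := hS.exact.lift (i ≫ g) (by rw [Category.assoc, hg, zero])
  have hl : l ≫ S.f = i ≫ g := hS.exact.lift_f _ _
  let φ : ShortComplex.mk i p zero ⟶ S :=
    { τ₁ := l, τ₂ := g, τ₃ := 𝟙 _, comm₁₂ := hl, comm₂₃ := by simpa using hg }
  refine ⟨hS, ?_⟩
  have nat := ShortComplex.ShortExact.extClass_naturality hp hS φ
  have e : (Abelian.Ext.mk₀ φ.τ₃).comp hS.extClass (zero_add 1) = hS.extClass :=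
    Abelian.Ext.mk₀_id_comp _
  rw [← e, ← nat]
  exact F.pushout_mem l _ hmem

/-- If `F` has enough projectives, then `F`-acyclicity is detected by the complexes
`Hom(P, -)` for `P` an `F`-projective object. -/
lemma acyclic_iff [F.EnoughProjectives] (K : CochainComplex A ℤ) :
    F.Acyclic K ↔ ∀ P, F.isProjective P → (homComplex P K).Acyclic := by
  constructor
  · intro hK P hP i
    rw [exactAt_homComplex_iff P K (i - 1) i (i + 1) (by lia) rfl]
    intro f hf
    obtain ⟨h₁, -⟩ := hK (i - 1) i (i + 1) (by lia) rfl
    have := h₁.mono_f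
    have hf' : f ≫ factorThruImage (K.d i (i + 1)) = 0 := by
      rw [← cancel_mono (image.ι _)]
      simpa using hf
    let l : P ⟶ image (K.d (i - 1) i) := h₁.exact.lift f hf'
    have hl : l ≫ image.ι _ = f := h₁.exact.lift_f _ _
    obtain ⟨g, hg⟩ := hP _ (hK (i - 1 - 1) (i - 1) i (by lia) (by lia)) l
    dsimp at g hg
    exact ⟨g, by rw [← hl, ← hg, Category.assoc, image.fac]⟩
  · intro hK h i j hi hj
    have key : ∀ P, F.isProjective P → ∀ (h i j : ℤ) (_ : h + 1 = i) (_ : i + 1 = j)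
        (f : P ⟶ K.X i), f ≫ K.d i j = 0 → ∃ g : P ⟶ K.X h, g ≫ K.d h i = f :=
      fun P hP h i j hi hj => (exactAt_homComplex_iff P K h i j hi hj).1 (hK P hP i)
    apply IsExact.of_lift
    · have : (imageSequence (K.d h i) (K.d i j) (K.d_comp_d h i j)).Exact := by
        rw [ShortComplex.exact_iff_exact_up_to_refinements]
        intro B x hx
        dsimp at x hx
        have hx' : x ≫ K.d i j = 0 := by
          rw [← image.fac (K.d i j), reassoc_of% hx, zero_comp]
        obtain ⟨P, p, hP, hp⟩ := exists_epi_isProjective (F := F) B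
        obtain ⟨g, hg⟩ := key P hP h i j hi hj (p ≫ x) (by rw [Category.assoc, hx', comp_zero])
        exact ⟨P, p, hp, g ≫ factorThruImage _, by simp [hg]⟩
      exact { exact := this, mono_f := by dsimp; infer_instance, epi_g := by dsimp; infer_instance }
    · intro P hP f
      dsimp at f
      obtain ⟨g, hg⟩ := key P hP i j (j + 1) hj rfl (f ≫ image.ι _) (by
        have : image.ι (K.d i j) ≫ K.d j (j + 1) = 0 := by
          rw [← cancel_epi (factorThruImage _)]; simp
        rw [Category.assoc, this, comp_zero])
      refine ⟨g, ?_⟩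
      dsimp
      rw [← cancel_mono (image.ι _)]
      simpa using hg

lemma acyclic_obj_iff [F.EnoughProjectives] (X : HomotopyCategory A (.up ℤ)) :
    F.acyclic X ↔ ∀ P, F.isProjective P →
      subcategoryAcyclic AddCommGrpCat.{v} ((homFunctor P).obj X) := by
  obtain ⟨K : CochainComplex _ _, rfl⟩ := HomotopyCategory.quotient_obj_surjective X
  refine (F.acyclic_iff K).trans ?_
  exact forall₂_congr fun P _ => (quotient_obj_mem_subcategoryAcyclic_iff_acyclic _).symm

instance [F.EnoughProjectives] : F.acyclic.IsClosedUnderIsomorphisms where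
  of_iso e h := by
    rw [acyclic_obj_iff] at h ⊢
    exact fun P hP => ObjectProperty.prop_of_iso _ ((homFunctor P).mapIso e) (h P hP)

instance [F.EnoughProjectives] : F.acyclic.IsTriangulated where
  exists_zero := ⟨0, isZero_zero _, by
    rw [acyclic_obj_iff]
    exact fun P _ => ObjectProperty.prop_of_isZero _ ((homFunctor P).map_isZero (isZero_zero _))⟩
  isStableUnderShiftBy n :=
    { le_shift := fun X h => by
        rw [ObjectProperty.prop_shift_iff]
        rw [acyclic_obj_iff] at h ⊢
        exact fun P hP => ((subcategoryAcyclic _).inverseImage (homFunctor P)).le_shift n _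
          (h P hP) }
  ext₂' T hT h₁ h₃ := by
    apply ObjectProperty.le_isoClosure
    rw [acyclic_obj_iff] at h₁ h₃ ⊢
    exact fun P hP => ((subcategoryAcyclic _).inverseImage (homFunctor P)).ext_of_isTriangulatedClosed₂
      T hT (h₁ P hP) (h₃ P hP)

/-! ### The relative derived categories -/

/-- The `F`-acyclic complexes in `K⁻(𝒜)`. -/
abbrev acyclicMinus : ObjectProperty (Minus A) := F.acyclic.inverseImage (minus A).ι

/-- The `F`-acyclic complexes in `Kᵇ(𝒜)`. -/
abbrev acyclicBounded : ObjectProperty (Bounded A) := F.acyclic.inverseImage (bounded A).ι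

/-- The bounded above relative derived category: the Verdier quotient of `K⁻(𝒜)` by the
`F`-acyclic complexes, that is, the localization at the morphisms with `F`-acyclic cone. -/
abbrev DMinus := F.acyclicMinus.trW.Localization

/-- The bounded relative derived category: the Verdier quotient of `Kᵇ(𝒜)` by the
`F`-acyclic complexes. -/
abbrev DBounded := F.acyclicBounded.trW.Localization

/-- The inclusion `Kᵇ(𝒜) ⥤ K⁻(𝒜)`, as a functor compatible with the localizations. -/
noncomputable abbrev boundedToMinusLocalizer :
    LocalizerMorphism F.acyclicBounded.trW F.acyclicMinus.trW where
  functor := HomotopyCategory.boundedToMinus A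
  map X Y f := by
    rintro ⟨Z, a, b, hT, hZ⟩
    exact ⟨_, _, _, (HomotopyCategory.boundedToMinus A).map_distinguished _ hT, hZ⟩

/-- The functor from the bounded to the bounded above relative derived category
that is induced by the inclusion `Kᵇ(𝒜) ⥤ K⁻(𝒜)`. -/
noncomputable abbrev boundedToMinus : F.DBounded ⥤ F.DMinus :=
  F.boundedToMinusLocalizer.localizedFunctor F.acyclicBounded.trW.Q F.acyclicMinus.trW.Q

/-! ### Bounded above complexes of `F`-projective objects -/

lemma isProjective_of_isZero {P : A} (hP : IsZero P) : F.isProjective P :=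
  fun _ _ _ => ⟨0, hP.eq_of_src _ _⟩

instance : F.isProjective.ContainsZero where
  exists_zero := ⟨0, isZero_zero A, F.isProjective_of_isZero (isZero_zero A)⟩

instance (J : Type*) : F.isProjective.IsClosedUnderColimitsOfShape (Discrete J) where
  colimitsOfShape_le := by
    rintro Y ⟨p⟩ S hS f
    choose g hg using fun j : J => p.prop_diag_obj ⟨j⟩ S hS (p.ι.app ⟨j⟩ ≫ f)
    refine ⟨p.isColimit.desc (Cocone.mk _ (Discrete.natTrans fun ⟨j⟩ => g j)),
      p.isColimit.hom_ext fun ⟨j⟩ => ?_⟩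
    rw [p.isColimit.fac_assoc]
    exact hg j

instance : HasFiniteCoproducts F.Projectives where
  out _ := inferInstance

instance : HasBinaryBiproducts F.Projectives :=
  HasBinaryBiproducts.of_hasBinaryCoproducts

/-- The natural functor from `K⁻(𝒫(F))` to the bounded above relative derived category:
the composition of the functor `K⁻(𝒫(F)) ⥤ K⁻(𝒜)` induced by the inclusion `𝒫(F) ⥤ 𝒜`
with the quotient functor. -/
noncomputable abbrev toDMinus : Minus F.Projectives ⥤ F.DMinus :=
  F.isProjective.ι.mapHomotopyCategoryMinus ⋙ F.acyclicMinus.trW.Q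

/-- The objects `X` of `K⁻(𝒫(F))` for which there is an integer `n` such that
`Hⁱ(Hom(P, X)) = 0` for all `i ≤ n` and all `F`-projective objects `P`. -/
def homBounded : ObjectProperty (Minus F.Projectives) :=
  fun X => ∃ n : ℤ, ∀ P, F.isProjective P → ∀ i ≤ n,
    IsZero ((homComplex P
      ((F.isProjective.ι.mapHomologicalComplex (.up ℤ)).obj X.obj.as)).homology i)

/-- The full subcategory of `K⁻(𝒫(F))` consisting of the complexes `X` such that the
cohomology of `Hom(P, X)` vanishes in low degrees, uniformly in the `F`-projective object `P`. -/
abbrev MinusHomBounded := F.homBounded.FullSubcategory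

/-- The functor `Hom(P, -) : K⁻(𝒫(F)) ⥤ K(Ab)`. -/
noncomputable abbrev homFunctorMinus (P : A) :
    Minus F.Projectives ⥤ HomotopyCategory AddCommGrpCat.{v} (.up ℤ) :=
  (minus F.Projectives).ι ⋙ F.isProjective.ι.mapHomotopyCategory (.up ℤ) ⋙ homFunctor P

lemma homBounded_iff (X : Minus F.Projectives) :
    F.homBounded X ↔ ∃ n : ℤ, ∀ P, F.isProjective P → ∀ i ≤ n,
      IsZero ((homologyFunctor AddCommGrpCat.{v} (.up ℤ) i).obj
        ((F.homFunctorMinus P).obj X)) := by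
  obtain ⟨X, hX⟩ := X
  obtain ⟨K : CochainComplex _ _, rfl⟩ := HomotopyCategory.quotient_obj_surjective X
  exact exists_congr fun n => forall₂_congr fun P _ => forall₂_congr fun i _ =>
    ((homologyFunctorFactors AddCommGrpCat.{v} (.up ℤ) i).app _).isZero_iff.symm

instance : F.homBounded.IsClosedUnderIsomorphisms where
  of_iso e h := by
    rw [homBounded_iff] at h ⊢
    obtain ⟨n, hn⟩ := h
    exact ⟨n, fun P hP i hi => (hn P hP i hi).of_iso
      ((homologyFunctor _ _ i).mapIso ((F.homFunctorMinus P).mapIso e.symm))⟩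

instance : F.homBounded.IsTriangulated where
  exists_zero := ⟨0, isZero_zero _, by
    rw [homBounded_iff]
    exact ⟨0, fun P _ i _ => Functor.map_isZero _ (Functor.map_isZero _ (isZero_zero _))⟩⟩
  isStableUnderShiftBy m :=
    { le_shift := fun X h => by
        rw [ObjectProperty.prop_shift_iff]
        rw [homBounded_iff] at h ⊢
        obtain ⟨n, hn⟩ := h
        refine ⟨n - m, fun P hP i hi => ?_⟩
        refine (hn P hP (m + i) (by lia)).of_iso
          ((homologyFunctor _ _ i).mapIso (((F.homFunctorMinus P).commShiftIso m).app X) ≪≫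
            ?_)
        exact ((homologyFunctor AddCommGrpCat.{v} (.up ℤ) 0).shiftIso m i (m + i) rfl).app _ }
  ext₂' T hT h₁ h₃ := by
    apply ObjectProperty.le_isoClosure
    rw [homBounded_iff] at h₁ h₃ ⊢
    obtain ⟨n₁, h₁⟩ := h₁
    obtain ⟨n₃, h₃⟩ := h₃
    refine ⟨min n₁ n₃, fun P hP i hi => ?_⟩
    have ex := (homologyFunctor AddCommGrpCat.{v} (.up ℤ) i).map_distinguished_exact _
      ((F.homFunctorMinus P).map_distinguished T hT)
    exact ex.isZero_of_both_zeros
      ((h₁ P hP i (hi.trans (min_le_left _ _))).eq_of_src _ _)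
      ((h₃ P hP i (hi.trans (min_le_right _ _))).eq_of_tgt _ _)

end ExtSubbifunctor

/-! ### Detecting `F`-acyclic cones by lifting along `F`-projective objects -/

namespace ExtSubbifunctor

open HomotopyCategory CochainComplex HomComplex

variable {A : Type u} [Category.{v} A] [Abelian A] [HasExt.{w} A] (F : ExtSubbifunctor.{w} A)

/-! With enough `F`-projectives, a complex is `F`-acyclic exactly when `Hom(P, -)` makes it acyclic
for every `F`-projective `P` (`acyclic_iff`), so the classical argument for projective resolutions
can be repeated relative to `F`.

For the unbounded statement, a morphism from a bounded above complex of `F`-projectives to an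
`F`-acyclic complex is null-homotopic (`leftOrthogonal_acyclic`). Hence morphisms out of such a
complex are the same in `K⁻(𝒜)` and in the Verdier quotient, and `toDMinus` is fully faithful. It is
essentially surjective because every bounded above complex has an `F`-projective resolution
(`exists_resolution`).

For the bounded statement, the vanishing of the cohomology of `Hom(P, -)` in low degrees is
invariant under morphisms with `F`-acyclic cone (`homExactLE_iff_of_trW`), and under this condition
a complex maps to one of its truncations with `F`-acyclic cone (`trW_πTruncGE`). So a denominator
that starts at a bounded complex can be continued to one that ends at a bounded complex
(`exists_trW_bounded`), which makes `boundedToMinus` fully faithful. Its essential image is that of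
`K^{-,Fb}(𝒫(F))` under `toDMinus`, and the second equivalence follows by inverting `boundedToMinus`
on this image. -/

lemma trW_quotient_map {K L : CochainComplex A ℤ} (φ : K ⟶ L)
    (h : F.Acyclic (mappingCone φ)) :
    F.acyclic.trW ((quotient A (.up ℤ)).map φ) :=
  .mk _ (mappingCone_triangleh_distinguished φ) h

lemma trW_hom {X Y : Minus A} (f : X ⟶ Y) (hf : F.acyclicMinus.trW f) :
    F.acyclic.trW f.hom := by
  obtain ⟨Z, a, b, hT, hZ⟩ := hf
  exact ⟨_, _, _, (minus A).ι.map_distinguished _ hT, hZ⟩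

section

variable [F.EnoughProjectives]

lemma acyclic_of_lift (K : CochainComplex A ℤ)
    (h : ∀ P, F.isProjective P → ∀ (i j k : ℤ), i + 1 = j → j + 1 = k →
      ∀ f : P ⟶ K.X j, f ≫ K.d j k = 0 → ∃ g : P ⟶ K.X i, g ≫ K.d i j = f) :
    F.Acyclic K := by
  rw [acyclic_iff]
  intro P hP j
  rw [exactAt_homComplex_iff P K (j - 1) j (j + 1) (by lia) rfl]
  exact h P hP _ _ _ (by lia) rfl

/-- The mapping cone of `φ` is `F`-acyclic if all pairs `(x, y)` of a cocycle of `Hom(P, K)` and a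
cochain of `Hom(P, L)` with `φ x = d y` lift. -/
lemma acyclic_mappingCone {K L : CochainComplex A ℤ} (φ : K ⟶ L)
    (h : ∀ P, F.isProjective P → ∀ (i j k l : ℤ), i + 1 = j → j + 1 = k → k + 1 = l →
      ∀ (x : P ⟶ K.X k) (y : P ⟶ L.X j), x ≫ K.d k l = 0 → x ≫ φ.f k = y ≫ L.d j k →
        ∃ (x' : P ⟶ K.X j) (y' : P ⟶ L.X i), x' ≫ K.d j k = x ∧
          x' ≫ φ.f j + y' ≫ L.d i j = y) :
    F.Acyclic (mappingCone φ) := by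
  apply acyclic_of_lift
  intro P hP i j k hij hjk f hf
  rw [mappingCone.ext_to_iff φ k (k + 1) rfl] at hf
  simp only [Category.assoc, mappingCone.d_fst_v φ j k (k + 1) hjk rfl,
    mappingCone.d_snd_v φ j k hjk, zero_comp, Preadditive.comp_neg, Preadditive.comp_add] at hf
  -- In the cone `d (x, y) = (-d x, φ x + d y)`, so a cocycle satisfies `φ x = d (-y)`: the second
  -- component enters with its sign changed.
  obtain ⟨x', y', hx, hy⟩ := h P hP i j k (k + 1) hij hjk rfl
    (f ≫ (mappingCone.fst φ).1.v j k hjk) (-(f ≫ (mappingCone.snd φ).v j j (add_zero j)))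
    (by simpa using hf.1) (by
      rw [Preadditive.neg_comp, eq_neg_iff_add_eq_zero]
      simpa using hf.2)
  rw [eq_neg_iff_add_eq_zero] at hy
  refine ⟨-(x' ≫ (mappingCone.inl φ).v j i (by lia)) - y' ≫ (mappingCone.inr φ).f i, ?_⟩
  rw [mappingCone.ext_to_iff φ j k hjk]
  constructor
  · simp [Preadditive.sub_comp, mappingCone.d_fst_v φ i j k hij hjk, hx]
  · simp only [Preadditive.sub_comp, Preadditive.neg_comp, Category.assoc,
      mappingCone.d_snd_v φ i j hij, Preadditive.comp_add]
    rw [← sub_eq_zero, ← neg_eq_zero, ← hy]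
    simp
    abel

lemma trW_minus {X Y : Minus A} (f : X ⟶ Y) (hf : F.acyclic.trW f.hom) :
    F.acyclicMinus.trW f := by
  obtain ⟨Z, a, b, hT⟩ := distinguished_cocone_triangle f
  exact (F.acyclicMinus.trW_iff_of_distinguished _ hT).2 <|
    (F.acyclic.trW_iff_of_distinguished _ ((minus A).ι.map_distinguished _ hT)).1 hf

end

end ExtSubbifunctor

/-! ### Null-homotopies built degree by degree -/

namespace CochainComplex

open HomComplex Preadditive

section

variable {C : Type*} [Category* C] [Preadditive C]

/-- The defect of the homotopy equation in degree `m` is killed by the incoming differential of `K`,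
because the equation holds in degree `n`. It therefore extends along the outgoing differential, and
adding the extension to `α` leaves the equation in degrees `≤ n` untouched. -/
lemma exists_eqUpTo_δ_add_single {K L : CochainComplex C ℤ}
    (f : K ⟶ L) (α : Cochain K L (-1)) (n m : ℤ) (hnm : n + 1 = m)
    (hm : ∀ (u : K.X m ⟶ L.X m), K.d n m ≫ u = 0 →
      ∃ (β : K.X (m + 1) ⟶ L.X m), K.d m (m + 1) ≫ β = u)
    (hα : (δ (-1) 0 α).EqUpTo (Cochain.ofHom f) n) :
    ∃ (h : K.X (m + 1) ⟶ L.X m),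
      (δ (-1) 0 (α + Cochain.single h (-1))).EqUpTo (Cochain.ofHom f) m := by
  subst hnm
  obtain ⟨β, hβ⟩ := hm (f.f (n + 1) - α.v (n + 1) n (by lia) ≫ L.d n (n + 1) -
    K.d (n + 1) (n + 1 + 1) ≫ α.v (n + 1 + 1) (n + 1) (by lia)) (by
      have eq := hα n n (add_zero n) (by rfl)
      simp only [δ_v (-1) 0 (neg_add_cancel 1) α n n (add_zero _) (n - 1) (n + 1)
        (by lia) (by lia), Int.negOnePow_zero, one_smul, Cochain.ofHom_v] at eq
      simp only [comp_sub, HomologicalComplex.d_comp_d_assoc, zero_comp,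
        ← f.comm, ← eq, add_comp, Category.assoc, L.d_comp_d, comp_zero, zero_add, sub_self])
  refine ⟨β, fun p q hpq hp => ?_⟩
  obtain rfl : p = q := by lia
  obtain hp | rfl := hp.lt_or_eq
  · rw [δ_add, Cochain.add_v, hα p p (by lia) (by lia), add_eq_left,
      δ_v (-1) 0 (neg_add_cancel 1) _ p p hpq (p - 1) (p + 1) rfl rfl,
      Cochain.single_v_eq_zero _ _ _ _ _ (by lia),
      Cochain.single_v_eq_zero _ _ _ _ _ (by lia)]
    simp
  · rw [δ_v (-1) 0 (neg_add_cancel 1) _ (n + 1) (n + 1) (by lia) n (n + 1 + 1)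
      (by lia) (by lia), Cochain.add_v,
      Cochain.single_v_eq_zero _ _ _ _ _ (by lia)]
    simp [hβ]

open Cochain.InductionUp in
/-- A morphism to a bounded below complex `L` is homotopic to zero if the differentials of its
source admit the extension property with respect to the objects of `L`. -/
lemma nonempty_homotopy_zero_of_isStrictlyGE {K L : CochainComplex C ℤ} (f : K ⟶ L) (d : ℤ)
    (hL : ∀ i < d, IsZero (L.X i))
    (hext : ∀ (n m : ℤ), n + 1 = m → ∀ (u : K.X m ⟶ L.X m), K.d n m ≫ u = 0 →
      ∃ (β : K.X (m + 1) ⟶ L.X m), K.d m (m + 1) ≫ β = u) :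
    Nonempty (Homotopy f 0) := by
  let X (n : ℕ) : Set (Cochain K L (-1)) :=
    Set.ofPred (fun α => (δ (-1) 0 α).EqUpTo (Cochain.ofHom f) (n + d - 1))
  let x₀ : X 0 := ⟨0, fun p q hpq hp ↦ IsZero.eq_of_tgt (hL _ (by lia)) _ _⟩
  let φ (n : ℕ) (α : X n) : X (n + 1) :=
    ⟨_, (exists_eqUpTo_δ_add_single f α.1 (n + d - 1) ((n + 1 : ℕ) + d - 1)
      (by lia) (hext _ _ (by lia)) α.2).choose_spec⟩
  have hφ (k : ℕ) (x : X k) : (φ k x).1.EqUpTo x.1 (d + k) := fun p q hpq hp => by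
    dsimp [φ]
    rw [add_eq_left, Cochain.single_v_eq_zero _ _ _ _ _ (by lia)]
  refine ⟨(Cochain.equivHomotopy f 0).symm ⟨limitSequence φ hφ x₀, ?_⟩⟩
  rw [Cochain.ofHom_zero, add_zero]
  ext n
  -- Stage `k₀` satisfies the homotopy equation in degree `n`, since `n ≤ k₀ + d - 1`. The limit
  -- agrees with it up to degree `d + k₀ ≥ n + 1`, which covers both components occurring in that
  -- equation.
  let k₀ := (n - d + 1).toNat
  rw [← (sequence φ x₀ k₀).2 n n (add_zero n) (by lia),
    δ_v (-1) 0 (neg_add_cancel 1) _ n n (by lia) (n - 1) (n + 1) rfl (by lia),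
    δ_v (-1) 0 (neg_add_cancel 1) _ n n (by lia) (n - 1) (n + 1) rfl (by lia),
    limitSequence_eqUpTo φ hφ x₀ k₀ n (n - 1) (by lia) (by lia),
    limitSequence_eqUpTo φ hφ x₀ k₀ (n + 1) n (by lia) (by lia)]

end

/-- A morphism from a bounded above complex `K` is homotopic to zero if the differentials of its
target admit the lifting property with respect to the objects of `K`. -/
lemma nonempty_homotopy_zero_of_isStrictlyLE {C : Type*} [Category* C] [Abelian C]
    {K L : CochainComplex C ℤ} (f : K ⟶ L) (c : ℤ) [K.IsStrictlyLE c]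
    (hlift : ∀ (i j k : ℤ), i + 1 = j → j + 1 = k → ∀ (u : K.X j ⟶ L.X j), u ≫ L.d j k = 0 →
      ∃ (β : K.X j ⟶ L.X i), β ≫ L.d i j = u) :
    Nonempty (Homotopy f 0) := by
  -- Passing to the opposite category negates degrees and turns the bounded above source `K` into a
  -- bounded below target.
  obtain ⟨h⟩ := nonempty_homotopy_zero_of_isStrictlyGE ((opEquivalence C).functor.map f.op) (-c)
    (fun i hi => (K.isZero_of_isStrictlyLE c (-i) (by lia)).op) (fun n m hnm u hu => by
      obtain ⟨β, hβ⟩ := hlift (-(m + 1)) (-m) (-n) (by lia) (by lia) u.unop (Quiver.Hom.op_inj hu)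
      exact ⟨β.op, Quiver.Hom.unop_inj hβ⟩)
  exact ⟨homotopyUnop (h.trans (.ofEq (by simp)))⟩

end CochainComplex

/-! ### Orthogonality of `F`-projective and `F`-acyclic complexes -/

namespace ExtSubbifunctor

open HomotopyCategory

variable {A : Type u} [Category.{v} A] [Abelian A] [HasExt.{w} A] (F : ExtSubbifunctor.{w} A)
  [F.EnoughProjectives]

/-- Bounded above complexes of `F`-projective objects are left orthogonal to `F`-acyclic
complexes. -/
lemma leftOrthogonal_acyclic (K : CochainComplex A ℤ) (c : ℤ) [K.IsStrictlyLE c]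
    (hK : ∀ i, F.isProjective (K.X i)) :
    F.acyclic.leftOrthogonal ((quotient A (.up ℤ)).obj K) := by
  intro L f hL
  obtain ⟨L, rfl⟩ := quotient_obj_surjective L
  obtain ⟨f, rfl⟩ := (quotient _ _).map_surjective f
  obtain ⟨h⟩ := CochainComplex.nonempty_homotopy_zero_of_isStrictlyLE f c
    (fun i j k hij hjk u hu =>
      (exactAt_homComplex_iff (K.X j) L i j k hij hjk).1 ((F.acyclic_iff L).1 hL _ (hK j) j) u hu)
  rw [eq_of_homotopy f 0 h, Functor.map_zero]

end ExtSubbifunctor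

/-! ### Resolutions by `F`-projective objects -/

namespace ExtSubbifunctor

open HomotopyCategory

variable {A : Type u} [Category.{v} A] [Abelian A] [HasExt.{w} A]

/-- The data in degree `c - n` in the inductive construction of a resolution of `K` by
`F`-projective objects. -/
structure ResolutionStage (F : ExtSubbifunctor.{w} A) (K : CochainComplex A ℤ) (c : ℤ) (n : ℕ) where
  /-- the object in degree `c - n` -/
  X : A
  isProjective : F.isProjective X
  /-- the object in degree `c - n + 1` -/
  T : A
  /-- the differential -/
  d : X ⟶ T
  /-- the morphism to `K` -/
  f (i : ℤ) (hi : i + n = c) : X ⟶ K.X i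

namespace ResolutionStage

variable {F : ExtSubbifunctor.{w} A} [F.EnoughProjectives] {K : CochainComplex A ℤ} {c : ℤ} {n : ℕ}

/-- The pairs `(x, y)` with `d x = 0` and `f x = d y`, which up to sign are the cocycles of the
cone, form the kernel of the map `g` below. The new object is an `F`-projective cover of this kernel
by an `F`-exact sequence, so every such pair defined on an `F`-projective object lifts to it. -/
lemma exists_next (s : ResolutionStage F K c n) :
    ∃ (s' : ResolutionStage F K c (n + 1)) (d : s'.X ⟶ s.X), d ≫ s.d = 0 ∧
      (∀ i j hi hj, s'.f i hi ≫ K.d i j = d ≫ s.f j hj) ∧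
      ∀ P, F.isProjective P → ∀ i j hi hj (x : P ⟶ s.X) (y : P ⟶ K.X i), x ≫ s.d = 0 →
        x ≫ s.f j hj = y ≫ K.d i j → ∃ z : P ⟶ s'.X, z ≫ d = x ∧ z ≫ s'.f i hi = y := by
  obtain ⟨i₀, hi₀⟩ : ∃ i : ℤ, i + (n + 1 : ℕ) = c := ⟨c - (n + 1 : ℕ), by lia⟩
  have hj₀ : i₀ + 1 + n = c := by lia
  let g : s.X ⊞ K.X i₀ ⟶ s.T ⊞ K.X (i₀ + 1) :=
    biprod.lift (biprod.fst ≫ s.d) (biprod.fst ≫ s.f _ hj₀ - biprod.snd ≫ K.d i₀ (i₀ + 1))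
  obtain ⟨Z, Q, a, p, zero, hQ, hp⟩ := EnoughProjectives.exists_isExact (F := F) (kernel g)
  have h₁ : kernel.ι g ≫ biprod.fst ≫ s.d = 0 := by
    have := kernel.condition g =≫ biprod.fst
    simpa only [g, Category.assoc, biprod.lift_fst, zero_comp] using this
  have h₂ : kernel.ι g ≫ biprod.snd ≫ K.d i₀ (i₀ + 1) =
      kernel.ι g ≫ biprod.fst ≫ s.f _ hj₀ := by
    have := kernel.condition g =≫ biprod.snd
    simp only [g, Category.assoc, biprod.lift_snd, zero_comp, Preadditive.comp_sub] at this
    exact (sub_eq_zero.1 this).symm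
  refine ⟨⟨Q, hQ, s.X, p ≫ kernel.ι g ≫ biprod.fst, fun i hi => p ≫ kernel.ι g ≫ biprod.snd ≫
    eqToHom (by rw [show i = i₀ by lia])⟩, p ≫ kernel.ι g ≫ biprod.fst, ?_, ?_, ?_⟩
  · simp [h₁]
  · intro i j hi hj
    obtain rfl : i = i₀ := by lia
    obtain rfl : j = i + 1 := by lia
    simp [h₂]
  · intro P hP i j hi hj x y hx hxy
    obtain rfl : i = i₀ := by lia
    obtain rfl : j = i + 1 := by lia
    obtain ⟨z, hz⟩ := hP _ hp (kernel.lift g (biprod.lift x y) (by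
      apply biprod.hom_ext <;> simp [g, hx, hxy]))
    refine ⟨z, ?_, ?_⟩ <;> simp [reassoc_of% hz]

/-- The stage following a given one. -/
noncomputable def next (s : ResolutionStage F K c n) : ResolutionStage F K c (n + 1) :=
  -- The field `T` of the chosen stage is unspecified; resetting it to `s.X` makes the differentials
  -- composable by definition.
  { s.exists_next.choose with
    T := s.X
    d := s.exists_next.choose_spec.choose }

variable (F K c) in
/-- The stages of a resolution of a complex that vanishes in degrees `≥ c`. -/
noncomputable def stage : ∀ n, ResolutionStage F K c n
  | 0 => ⟨0, F.isProjective_of_isZero (isZero_zero _), 0, 0, fun _ _ => 0⟩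
  | n + 1 => (stage n).next

end ResolutionStage

/-- The chain complex underlying a resolution of `K`, indexed by the distance to the degree `c`. -/
lemma exists_chainComplex (F : ExtSubbifunctor.{w} A) [F.EnoughProjectives]
    (K : CochainComplex A ℤ) (c : ℤ) :
    ∃ (Y : ChainComplex A ℕ) (f : ∀ (n : ℕ) (i : ℤ), i + n = c → (Y.X n ⟶ K.X i)),
      (∀ n, F.isProjective (Y.X n)) ∧ IsZero (Y.X 0) ∧
      (∀ m n i j hi hj, m = n + 1 → f m i hi ≫ K.d i j = Y.d m n ≫ f n j hj) ∧
      ∀ P, F.isProjective P → ∀ m n i j hi hj, m = n + 1 → ∀ (x : P ⟶ Y.X n) (y : P ⟶ K.X i),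
        (∀ l, x ≫ Y.d n l = 0) → x ≫ f n j hj = y ≫ K.d i j →
          ∃ z : P ⟶ Y.X m, z ≫ Y.d m n = x ∧ z ≫ f m i hi = y := by
  let s := ResolutionStage.stage F K c
  let Y : ChainComplex A ℕ := .of (fun n => (s n).X) (fun n => (s n).next.d)
    (fun n => (s (n + 1)).exists_next.choose_spec.choose_spec.1)
  have hd (n : ℕ) : Y.d (n + 1) n = (s n).next.d :=
    ChainComplex.of_d (fun n => (s n).X) (fun n => (s n).next.d) n
  refine ⟨Y, fun n => (s n).f, fun n => (s n).isProjective, isZero_zero A, ?_, ?_⟩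
  · rintro _ n i j hi hj rfl
    rw [hd]
    exact (s n).exists_next.choose_spec.choose_spec.2.1 i j hi hj
  · rintro P hP _ n i j hi hj rfl x y hx hxy
    rw [hd]
    refine (s n).exists_next.choose_spec.choose_spec.2.2 P hP i j hi hj x y ?_ hxy
    obtain _ | n := n
    · exact (isZero_zero A).eq_of_tgt _ _
    · have := hx n
      rwa [hd] at this

open Classical in
/-- A complex `K` that vanishes in degrees `≥ c` admits a resolution by a bounded above complex
of `F`-projective objects. -/
lemma exists_resolution (F : ExtSubbifunctor.{w} A) [F.EnoughProjectives]
    (K : CochainComplex A ℤ) (c : ℤ) (hc : ∀ i, c ≤ i → IsZero (K.X i)) :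
    ∃ (X : CochainComplex A ℤ) (f : X ⟶ K), (∀ i, F.isProjective (X.X i)) ∧
      X.IsStrictlyLE c ∧ F.Acyclic (CochainComplex.mappingCone f) := by
  obtain ⟨Y, f, hY, hY₀, comm, lift⟩ := exists_chainComplex F K c
  have hY' (i : ℤ) (hi : c ≤ i) : IsZero (Y.X (c - i).toNat) := by
    rwa [show (c - i).toNat = 0 by lia]
  -- `toNat` sends every degree `≥ c` to the zero object `Y.X 0`, so truncated subtraction does no
  -- harm, and the default value `0` of `φ` below is only taken in degrees `> c`.
  let X : CochainComplex A ℤ :=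
    { X i := Y.X (c - i).toNat
      d i j := Y.d (c - i).toNat (c - j).toNat
      shape i j hij := by
        by_cases hj : j < c
        · exact Y.shape _ _ (by simp at hij ⊢; lia)
        · exact (hY' j (by lia)).eq_of_tgt _ _ }
  let φ : X ⟶ K :=
    { f i := if h : i + (c - i).toNat = c then f (c - i).toNat i h else 0
      comm' i j hij := by
        obtain rfl : i + 1 = j := hij
        by_cases hi : i < c
        · rw [dif_pos (by lia), dif_pos (by lia)]
          exact comm _ _ _ _ _ _ (by lia)
        · exact (hY' i (by lia)).eq_of_src _ _ }
  have hφ (i : ℤ) (h : i + (c - i).toNat = c) : φ.f i = f (c - i).toNat i h := dif_pos h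
  refine ⟨X, φ, fun i => hY _, ?_, ?_⟩
  · rw [CochainComplex.isStrictlyLE_iff]
    exact fun i hi => hY' i (by lia)
  · refine F.acyclic_mappingCone φ fun P hP i j k l hij hjk hkl x y hx hxy => ?_
    by_cases hj : j < c
    · rw [hφ k (by lia)] at hxy
      obtain ⟨z, hz, hz'⟩ := lift P hP (c - j).toNat (c - k).toNat j k (by lia) (by lia) (by lia)
        x y (fun m => by
          by_cases hm : m + 1 = (c - k).toNat
          · obtain rfl : m = (c - l).toNat := by lia
            exact hx
          · rw [Y.shape _ _ (by simpa using hm), comp_zero]) hxy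
      refine ⟨z, 0, hz, ?_⟩
      rw [hφ j (by lia), hz', zero_comp, add_zero]
    · exact ⟨0, 0, (hY' k (by lia)).eq_of_tgt _ _, (hc j (by lia)).eq_of_tgt _ _⟩

end ExtSubbifunctor

/-! ### Vanishing in low degrees and truncation -/

namespace ExtSubbifunctor

open HomotopyCategory

variable {A : Type u} [Category.{v} A] [Abelian A] [HasExt.{w} A] (F : ExtSubbifunctor.{w} A)

/-- The complexes `K` such that `Hⁱ(Hom(P, K)) = 0` for all `i ≤ n` and all `F`-projective
objects `P`. -/
def homExactLE (n : ℤ) : ObjectProperty (HomotopyCategory A (.up ℤ)) :=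
  fun X => ∀ P, F.isProjective P → ∀ i ≤ n,
    IsZero ((homologyFunctor AddCommGrpCat.{v} (.up ℤ) i).obj ((homFunctor P).obj X))

lemma homExactLE_quotient_obj_iff (K : CochainComplex A ℤ) (n : ℤ) :
    F.homExactLE n ((quotient A (.up ℤ)).obj K) ↔
      ∀ P, F.isProjective P → ∀ i ≤ n, (homComplex P K).ExactAt i :=
  forall₂_congr fun _ _ => forall₂_congr fun i _ =>
    (((homologyFunctorFactors AddCommGrpCat.{v} (.up ℤ) i).app _).isZero_iff).trans
      (HomologicalComplex.exactAt_iff_isZero_homology _ _).symm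

lemma homBounded_iff_homExactLE (X : Minus F.Projectives) :
    F.homBounded X ↔ ∃ n, F.homExactLE n (F.isProjective.ι.mapHomotopyCategoryMinus.obj X).obj :=
  F.homBounded_iff X

lemma homExactLE_of_isStrictlyGE (K : CochainComplex A ℤ) (n m : ℤ) (hnm : n < m)
    [K.IsStrictlyGE m] : F.homExactLE n ((quotient A (.up ℤ)).obj K) := by
  rw [homExactLE_quotient_obj_iff]
  intro P hP i hi
  exact .of_isZero ((preadditiveCoyoneda.obj (op P)).map_isZero
    (K.isZero_of_isStrictlyGE m i (by lia)))

variable [F.EnoughProjectives]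

/-- `Hom(P, -)` sends the `F`-acyclic cone of `f` to an acyclic complex, hence `f` to a
quasi-isomorphism. -/
lemma homExactLE_iff_of_trW {X Y : HomotopyCategory A (.up ℤ)} (f : X ⟶ Y) (hf : F.acyclic.trW f)
    (n : ℤ) : F.homExactLE n X ↔ F.homExactLE n Y := by
  refine forall₂_congr fun P hP => forall₂_congr fun i _ => ?_
  have : quasiIso AddCommGrpCat.{v} (.up ℤ) ((homFunctor P).map f) := by
    rw [quasiIso_eq_trW_subcategoryAcyclic]
    obtain ⟨Z, a, b, hT, hZ⟩ := hf
    exact ⟨_, _, _, (homFunctor P).map_distinguished _ hT, (F.acyclic_obj_iff Z).1 hZ P hP⟩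
  have := this i
  exact (asIso ((homologyFunctor _ _ i).map ((homFunctor P).map f))).isZero_iff

/-- If `Hⁱ(Hom(P, K)) = 0` for all `i ≤ n + 1` and all `F`-projective objects `P`, then the
truncation morphism `K ⟶ τ≥n K` has an `F`-acyclic cone. -/
lemma trW_πTruncGE (K : CochainComplex A ℤ) (n : ℤ)
    (hK : F.homExactLE (n + 1) ((quotient A (.up ℤ)).obj K)) :
    F.acyclic.trW ((quotient A (.up ℤ)).map (K.πTruncGE n)) := by
  rw [homExactLE_quotient_obj_iff] at hK
  have lift (P : A) (hP : F.isProjective P) (i j k : ℤ) (hij : i + 1 = j) (hjk : j + 1 = k)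
      (hj : j ≤ n + 1) (f : P ⟶ K.X j) (hf : f ≫ K.d j k = 0) : ∃ g, g ≫ K.d i j = f :=
    (exactAt_homComplex_iff P K i j k hij hjk).1 (hK P hP j hj) f hf
  have hzero (i : ℤ) (hi : i < n) : IsZero ((K.truncGE n).X i) :=
    (K.truncGE n).isZero_of_isStrictlyGE n i hi
  have hiso (i : ℤ) (hi : n < i) : IsIso ((K.πTruncGE n).f i) := by
    obtain ⟨m, rfl⟩ : ∃ m : ℕ, i = n + m := ⟨(i - n).toNat, by lia⟩
    refine (ComplexShape.Embedding.isIso_liftExtend_f_iff _ _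
      (K.restrictionToTruncGE'_hasLift _) (i := m) rfl).2 ?_
    apply HomologicalComplex.isIso_restrictionToTruncGE'
    rw [ComplexShape.boundaryGE_embeddingUpIntGE_iff]
    lia
  have hepi (i : ℤ) : Epi ((K.πTruncGE n).f i) := by
    dsimp [CochainComplex.πTruncGE]; infer_instance
  -- After refinement to an `F`-projective source, an element of the kernel comes from a cocycle of
  -- `K`. By exactness this is a boundary from degree `n - 1`, where the truncation is zero.
  have hmono (i j : ℤ) (hi : i = n) (hij : i + 1 = j) : Mono ((K.truncGE n).d i j) := by
    rw [Preadditive.mono_iff_cancel_zero]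
    intro B y hy
    obtain ⟨B', p, hp, x, hx⟩ := surjective_up_to_refinements_of_epi ((K.πTruncGE n).f i) y
    obtain ⟨P, q, hP, hq⟩ := exists_epi_isProjective (F := F) B'
    have := hiso j (by lia)
    obtain ⟨g, hg⟩ := lift P hP (i - 1) i j (by lia) hij (by lia) (q ≫ x) (by
      rw [← cancel_mono ((K.πTruncGE n).f j), zero_comp, Category.assoc, Category.assoc,
        ← HomologicalComplex.Hom.comm, ← reassoc_of% hx, hy, comp_zero, comp_zero])
    rw [← cancel_epi p, ← cancel_epi q, hx, ← Category.assoc, ← hg, Category.assoc,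
      ← HomologicalComplex.Hom.comm, (hzero (i - 1) (by lia)).eq_of_tgt ((K.πTruncGE n).f _) 0,
      zero_comp, comp_zero, comp_zero, comp_zero]
  apply F.trW_quotient_map
  refine F.acyclic_mappingCone _ fun P hP i j k l hij hjk hkl x y hx hxy => ?_
  obtain hj | rfl | hj := lt_trichotomy j n
  · obtain ⟨x', hx'⟩ := lift P hP j k l hjk hkl (by lia) x hx
    exact ⟨x', 0, hx', (hzero j hj).eq_of_tgt _ _⟩
  -- In degree `n`, `y` need not lift along the epimorphism `K ⟶ τ≥n K`, as `P` is only
  -- `F`-projective. Exactness in degree `n + 1` provides `x'` instead, and injectivity of the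
  -- differential of the truncation shows that it maps to `y`.
  · obtain ⟨x', hx'⟩ := lift P hP j k l hjk hkl (by lia) x hx
    have := hmono j k rfl hjk
    refine ⟨x', 0, hx', ?_⟩
    rw [← cancel_mono ((K.truncGE j).d j k), zero_comp, add_zero, Category.assoc,
      HomologicalComplex.Hom.comm, reassoc_of% hx', hxy]
  · have := hiso j hj
    have := hiso k (by lia)
    refine ⟨y ≫ inv ((K.πTruncGE n).f j), 0, ?_, by simp⟩
    rw [← cancel_mono ((K.πTruncGE n).f k), hxy]
    simp [← HomologicalComplex.Hom.comm]

end ExtSubbifunctor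

/-! ### Full faithfulness of a localized functor -/

namespace CategoryTheory.LocalizerMorphism

variable {C₁ C₂ D₁ D₂ : Type*} [Category* C₁] [Category* C₂] [Category* D₁] [Category* D₂]
  {W₁ : MorphismProperty C₁} {W₂ : MorphismProperty C₂} (Φ : LocalizerMorphism W₁ W₂)
  [W₂.HasLeftCalculusOfFractions]
  (L₁ : C₁ ⥤ D₁) (L₂ : C₂ ⥤ D₂) [L₁.IsLocalization W₁] [L₂.IsLocalization W₂]

section

variable (hΦ : ∀ ⦃X : C₁⦄ ⦃Y : C₂⦄ (s : Φ.functor.obj X ⟶ Y), W₂ s →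
    ∃ (Z : C₁) (b : Y ⟶ Φ.functor.obj Z) (t : X ⟶ Z), W₁ t ∧ s ≫ b = Φ.functor.map t)

-- Two morphisms identified by `L₂` become equal after some `s` in `W₂`; `hΦ` replaces `s` by the
-- image of some `t` in `W₁`, and faithfulness of `Φ` descends the equality. General morphisms of
-- the localization reduce to this through a common denominator.
include hΦ in
lemma faithful_localizedFunctor [W₁.HasLeftCalculusOfFractions] [Φ.functor.Faithful] :
    (Φ.localizedFunctor L₁ L₂).Faithful := by
  let G := Φ.localizedFunctor L₁ L₂
  let e : Φ.functor ⋙ L₂ ≅ L₁ ⋙ G := CatCommSq.iso Φ.functor L₁ L₂ G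
  have key {X Y : C₁} (f g : X ⟶ Y) (h : G.map (L₁.map f) = G.map (L₁.map g)) :
      L₁.map f = L₁.map g := by
    have h' : L₂.map (Φ.functor.map f) = L₂.map (Φ.functor.map g) := by
      have h₁ := e.hom.naturality f
      have h₂ := e.hom.naturality g
      dsimp at h₁ h₂
      rw [← cancel_mono (e.hom.app Y), h₁, h₂, h]
    rw [MorphismProperty.map_eq_iff_postcomp L₂ W₂] at h'
    obtain ⟨Z, s, hs, fac⟩ := h'
    obtain ⟨Z', b, t, ht, fac'⟩ := hΦ s hs
    rw [MorphismProperty.map_eq_iff_postcomp L₁ W₁]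
    refine ⟨Z', t, ht, Φ.functor.map_injective ?_⟩
    simp only [Functor.map_comp, ← fac', reassoc_of% fac]
  have := Localization.essSurj L₁ W₁
  have key' {X Y : C₁} (f g : L₁.obj X ⟶ L₁.obj Y) (h : G.map f = G.map g) : f = g := by
    obtain ⟨φ, rfl, rfl⟩ := Localization.exists_leftFraction₂ L₁ W₁ f g
    have := Localization.inverts L₁ W₁ φ.s φ.hs
    rw [← cancel_mono (L₁.map φ.s)]
    have h₁ := φ.fst.map_comp_map_s L₁ (Localization.inverts L₁ W₁)
    have h₂ := φ.snd.map_comp_map_s L₁ (Localization.inverts L₁ W₁)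
    dsimp at h₁ h₂
    rw [h₁, h₂]
    apply key
    rw [← h₁, ← h₂, G.map_comp, G.map_comp, h]
  refine ⟨fun {X Y f g} h => ?_⟩
  rw [← cancel_epi (L₁.objObjPreimageIso X).hom, ← cancel_mono (L₁.objObjPreimageIso Y).inv]
  apply key'
  simp only [Functor.map_comp]
  rw [show G.map f = G.map g from h]

-- Prolonging a left fraction by the `b` of `hΦ` turns its denominator into the image of some `t` in
-- `W₁`; its numerator then lifts because `Φ` is full.
include hΦ in
lemma full_localizedFunctor [Φ.functor.Full] : (Φ.localizedFunctor L₁ L₂).Full := by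
  let G := Φ.localizedFunctor L₁ L₂
  let e : Φ.functor ⋙ L₂ ≅ L₁ ⋙ G := CatCommSq.iso Φ.functor L₁ L₂ G
  have := Localization.essSurj L₁ W₁
  refine G.full_of_comp_essSurj L₁ fun X Y φ => ?_
  obtain ⟨ψ, hψ⟩ := Localization.exists_leftFraction L₂ W₂ (e.hom.app X ≫ φ ≫ e.inv.app Y)
  obtain ⟨Z, b, t, ht, fac⟩ := hΦ ψ.s ψ.hs
  obtain ⟨f, hf⟩ := Φ.functor.map_surjective (ψ.f ≫ b)
  have := Localization.inverts L₁ W₁ t ht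
  refine ⟨L₁.map f ≫ CategoryTheory.inv (L₁.map t), ?_⟩
  have hψ' : e.hom.app X ≫ φ ≫ e.inv.app Y ≫ L₂.map ψ.s = L₂.map ψ.f := by
    have := ψ.map_comp_map_s L₂ (Localization.inverts L₂ W₂)
    rw [← this, ← hψ]
    simp
  have hf' := e.hom.naturality f
  have ht' := e.hom.naturality t
  dsimp at hf' ht'
  have ht'' : e.inv.app Y ≫ L₂.map (Φ.functor.map t) ≫ e.hom.app Z = G.map (L₁.map t) := by
    rw [ht', ← NatTrans.comp_app_assoc, e.inv_hom_id]
    simp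
  rw [← cancel_mono (G.map (L₁.map t)), ← G.map_comp, Category.assoc, IsIso.inv_hom_id,
    Category.comp_id, ← cancel_epi (e.hom.app X), ← ht'', ← fac, ← hf', hf]
  simp only [Functor.map_comp, Category.assoc]
  rw [← reassoc_of% hψ']

end

end CategoryTheory.LocalizerMorphism

/-! ### The two equivalences -/

namespace ExtSubbifunctor

open HomotopyCategory

variable {A : Type u} [Category.{v} A] [Abelian A] [HasExt.{w} A] (F : ExtSubbifunctor.{w} A)

instance : F.isProjective.ι.mapHomotopyCategoryMinus.Full :=
  inferInstanceAs ((minus A).lift ((minus F.Projectives).ι ⋙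
    F.isProjective.ι.mapHomotopyCategory (.up ℤ)) _).Full

instance : F.isProjective.ι.mapHomotopyCategoryMinus.Faithful :=
  inferInstanceAs ((minus A).lift ((minus F.Projectives).ι ⋙
    F.isProjective.ι.mapHomotopyCategory (.up ℤ)) _).Faithful

lemma homExactLE_of_bounded (X : Bounded A) : ∃ n, F.homExactLE n X.obj := by
  obtain ⟨X, ⟨m, hm⟩, -⟩ := X
  obtain ⟨X, rfl⟩ := quotient_obj_surjective X
  have : CochainComplex.IsStrictlyGE X m := hm
  exact ⟨m - 1, F.homExactLE_of_isStrictlyGE X (m - 1) m (by lia)⟩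

variable [F.EnoughProjectives]

/-- The isomorphism expressing that `boundedToMinus` is induced by `Kᵇ(𝒜) ⥤ K⁻(𝒜)`. -/
noncomputable def boundedToMinusIso :
    HomotopyCategory.boundedToMinus A ⋙ F.acyclicMinus.trW.Q ≅
      F.acyclicBounded.trW.Q ⋙ F.boundedToMinus :=
  (F.boundedToMinusLocalizer.catCommSq F.acyclicBounded.trW.Q F.acyclicMinus.trW.Q).iso

instance : NatTrans.CommShift F.boundedToMinusIso.hom ℤ :=
  LocalizerMorphism.natTransCommShift_hom (M := ℤ) F.boundedToMinusLocalizer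
    F.acyclicBounded.trW.Q F.acyclicMinus.trW.Q F.boundedToMinus F.boundedToMinusIso

instance : F.boundedToMinus.IsTriangulated :=
  have := Localization.essSurj_mapArrow F.acyclicBounded.trW.Q F.acyclicBounded.trW
  Functor.isTriangulated_of_precomp_iso F.boundedToMinusIso.symm

lemma leftOrthogonal_acyclicMinus (X : Minus F.Projectives) :
    F.acyclicMinus.leftOrthogonal (F.isProjective.ι.mapHomotopyCategoryMinus.obj X) := by
  intro L f hL
  obtain ⟨X, c, hX⟩ := X
  obtain ⟨X, rfl⟩ := quotient_obj_surjective X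
  have : CochainComplex.IsStrictlyLE X c := hX
  have : CochainComplex.IsStrictlyLE
    ((F.isProjective.ι.mapHomologicalComplex (.up ℤ)).obj X) c := inferInstance
  exact (minus A).ι.map_injective (F.leftOrthogonal_acyclic
    ((F.isProjective.ι.mapHomologicalComplex (.up ℤ)).obj X) c (fun i => (X.X i).property) _ hL)

instance : F.toDMinus.Faithful where
  map_injective {X _} _ _ h :=
    F.isProjective.ι.mapHomotopyCategoryMinus.map_injective
      (((F.leftOrthogonal_acyclicMinus X).map_bijective_of_isTriangulated
        F.acyclicMinus.trW.Q _).1 h)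

instance : F.toDMinus.Full where
  map_surjective {X _} f := by
    obtain ⟨g, rfl⟩ := ((F.leftOrthogonal_acyclicMinus X).map_bijective_of_isTriangulated
      F.acyclicMinus.trW.Q _).2 f
    obtain ⟨h, rfl⟩ := F.isProjective.ι.mapHomotopyCategoryMinus.map_surjective g
    exact ⟨h, rfl⟩

/-- Any object of `K⁻(𝒜)` admits a resolution by an object of `K⁻(𝒫(F))`. -/
lemma exists_trW_minus (Y : Minus A) :
    ∃ (X : Minus F.Projectives) (f : F.isProjective.ι.mapHomotopyCategoryMinus.obj X ⟶ Y),
      F.acyclicMinus.trW f := by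
  obtain ⟨Y, c, hY⟩ := Y
  obtain ⟨Y, rfl⟩ := quotient_obj_surjective Y
  have : CochainComplex.IsStrictlyLE Y c := hY
  -- `Y` may be nonzero in degree `c`, while the resolution requires vanishing from its bound on.
  obtain ⟨X, f, hX, hX', hf⟩ := exists_resolution F Y (c + 1)
    (fun i hi => CochainComplex.isZero_of_isStrictlyLE Y c i (by lia))
  let X' : CochainComplex F.Projectives ℤ := HomologicalComplex.liftObjectProperty _ X hX
  have : X'.IsStrictlyLE (c + 1) := by
    rwa [← CochainComplex.isStrictlyLE_mapHomologicalComplex_obj_iff _ F.isProjective.ι]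
  exact ⟨⟨(quotient _ _).obj X', c + 1, this⟩, ObjectProperty.homMk ((quotient A (.up ℤ)).map f),
    F.trW_minus _ (F.trW_quotient_map f hf)⟩

instance : F.toDMinus.EssSurj where
  mem_essImage Y := by
    have := Localization.essSurj F.acyclicMinus.trW.Q F.acyclicMinus.trW
    obtain ⟨X, f, hf⟩ := F.exists_trW_minus (F.acyclicMinus.trW.Q.objPreimage Y)
    have := Localization.inverts F.acyclicMinus.trW.Q _ f hf
    exact ⟨X, ⟨asIso (F.acyclicMinus.trW.Q.map f) ≪≫ F.acyclicMinus.trW.Q.objObjPreimageIso Y⟩⟩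

/-- An object of `K⁻(𝒜)` whose `Hom(P, -)`-cohomology vanishes in low degrees is isomorphic in
the relative derived category to a bounded complex. -/
lemma exists_trW_to_bounded (Y : Minus A) (n : ℤ) (hY : F.homExactLE n Y.obj) :
    ∃ (Z : Bounded A) (f : Y ⟶ (HomotopyCategory.boundedToMinus A).obj Z),
      F.acyclicMinus.trW f := by
  obtain ⟨Y, c, hc⟩ := Y
  obtain ⟨Y, rfl⟩ := quotient_obj_surjective Y
  have : CochainComplex.IsStrictlyLE Y c := hc
  -- `trW_πTruncGE` needs exactness one degree above the truncation degree, hence `n - 1`.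
  let Z : CochainComplex A ℤ := CochainComplex.truncGE Y (n - 1)
  have hZ : Z.IsStrictlyLE c := inferInstance
  have hZ' : Z.IsStrictlyGE (n - 1) := inferInstance
  exact ⟨⟨(quotient _ _).obj Z, ⟨_, hZ'⟩, ⟨_, hZ⟩⟩,
    ObjectProperty.homMk ((quotient A (.up ℤ)).map (CochainComplex.πTruncGE Y (n - 1))),
    F.trW_minus _ (F.trW_πTruncGE Y (n - 1) (by simpa using hY))⟩

instance : (HomotopyCategory.boundedToMinus A).Full :=
  inferInstanceAs ((minus A).lift (bounded A).ι minus_of_bounded).Full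

instance : (HomotopyCategory.boundedToMinus A).Faithful :=
  inferInstanceAs ((minus A).lift (bounded A).ι minus_of_bounded).Faithful

/-- This is the cofinality hypothesis of the localization lemmas. Low-degree vanishing passes from
the bounded `X` to `Y` along `s`, so `Y` can be truncated to a bounded complex. -/
lemma exists_trW_bounded ⦃X : Bounded A⦄ ⦃Y : Minus A⦄
    (s : (HomotopyCategory.boundedToMinus A).obj X ⟶ Y) (hs : F.acyclicMinus.trW s) :
    ∃ (Z : Bounded A) (b : Y ⟶ (HomotopyCategory.boundedToMinus A).obj Z) (t : X ⟶ Z),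
      F.acyclicBounded.trW t ∧ s ≫ b = (HomotopyCategory.boundedToMinus A).map t := by
  obtain ⟨n, hn⟩ := F.homExactLE_of_bounded X
  obtain ⟨Z, b, hb⟩ := F.exists_trW_to_bounded Y n
    ((F.homExactLE_iff_of_trW _ (F.trW_hom s hs) n).1 hn)
  obtain ⟨t, ht⟩ := (HomotopyCategory.boundedToMinus A).map_surjective (s ≫ b)
  refine ⟨Z, b, t, ?_, ht.symm⟩
  obtain ⟨W, a, c, hT⟩ := distinguished_cocone_triangle t
  refine (F.acyclicBounded.trW_iff_of_distinguished _ hT).2 ?_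
  refine (F.acyclicMinus.trW_iff_of_distinguished _
    ((HomotopyCategory.boundedToMinus A).map_distinguished _ hT)).1 ?_
  change F.acyclicMinus.trW ((HomotopyCategory.boundedToMinus A).map t)
  rw [ht]
  exact MorphismProperty.comp_mem _ _ _ hs hb

instance : F.boundedToMinus.Full :=
  F.boundedToMinusLocalizer.full_localizedFunctor _ _ F.exists_trW_bounded

instance : F.boundedToMinus.Faithful :=
  F.boundedToMinusLocalizer.faithful_localizedFunctor _ _ F.exists_trW_bounded

/-- Truncating `X` produces the required bounded complex; this makes the lift `toDBounded` possible.
-/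
lemma essImage_boundedToMinus (X : F.MinusHomBounded) :
    F.boundedToMinus.essImage (F.toDMinus.obj X.obj) := by
  obtain ⟨n, hn⟩ := (F.homBounded_iff_homExactLE _).1 X.property
  obtain ⟨Z, f, hf⟩ := F.exists_trW_to_bounded _ n hn
  have := Localization.inverts F.acyclicMinus.trW.Q _ f hf
  exact ⟨F.acyclicBounded.trW.Q.obj Z,
    ⟨(F.boundedToMinusIso.app Z).symm ≪≫ (asIso (F.acyclicMinus.trW.Q.map f)).symm⟩⟩

/-- An `F`-projective resolution of a bounded complex inherits its low-degree vanishing. This gives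
essential surjectivity of `toDBounded`. -/
lemma exists_toDMinus_iso (Y : F.DBounded) :
    ∃ X : F.MinusHomBounded, Nonempty (F.toDMinus.obj X.obj ≅ F.boundedToMinus.obj Y) := by
  have := Localization.essSurj F.acyclicBounded.trW.Q F.acyclicBounded.trW
  obtain ⟨X, f, hf⟩ := F.exists_trW_minus
    ((HomotopyCategory.boundedToMinus A).obj (F.acyclicBounded.trW.Q.objPreimage Y))
  have := Localization.inverts F.acyclicMinus.trW.Q _ f hf
  obtain ⟨n, hn⟩ := F.homExactLE_of_bounded (F.acyclicBounded.trW.Q.objPreimage Y)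
  exact ⟨⟨X, (F.homBounded_iff_homExactLE _).2
    ⟨n, (F.homExactLE_iff_of_trW _ (F.trW_hom f hf) n).2 hn⟩⟩,
    ⟨asIso (F.acyclicMinus.trW.Q.map f) ≪≫ F.boundedToMinusIso.app _ ≪≫
      F.boundedToMinus.mapIso (F.acyclicBounded.trW.Q.objObjPreimageIso Y)⟩⟩

/-- The functor from `K^{-,Fb}(𝒫(F))` to the bounded relative derived category. -/
noncomputable def toDBounded : F.MinusHomBounded ⥤ F.DBounded :=
  F.boundedToMinus.essImage.lift (F.homBounded.ι ⋙ F.toDMinus) F.essImage_boundedToMinus ⋙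
    F.boundedToMinus.toEssImage.inv

/-- The functor `toDBounded` is induced by `toDMinus`. -/
noncomputable def toDBoundedIso :
    F.toDBounded ⋙ F.boundedToMinus ≅ F.homBounded.ι ⋙ F.toDMinus :=
  Functor.isoWhiskerLeft (F.boundedToMinus.essImage.lift (F.homBounded.ι ⋙ F.toDMinus)
    F.essImage_boundedToMinus) (Functor.isoWhiskerRight
      F.boundedToMinus.toEssImage.asEquivalence.counitIso F.boundedToMinus.essImage.ι)

/-- As `boundedToMinus` is fully faithful, the compatibility with shifts is pulled back from the
composite with it, which makes `toDBoundedIso` compatible with shifts. -/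
noncomputable instance : F.toDBounded.CommShift ℤ := .ofComp F.toDBoundedIso ℤ

instance : NatTrans.CommShift F.toDBoundedIso.hom ℤ :=
  Functor.CommShift.ofComp_compatibility F.toDBoundedIso ℤ

instance : F.toDBounded.IsTriangulated :=
  (Functor.isTriangulated_iff_comp_right F.toDBoundedIso).2 inferInstance

instance : F.toDBounded.Faithful :=
  have := Functor.Faithful.of_iso F.toDBoundedIso.symm
  Functor.Faithful.of_comp F.toDBounded F.boundedToMinus

instance : F.toDBounded.Full :=
  have := Functor.Full.of_iso F.toDBoundedIso.symm
  Functor.Full.of_comp_faithful F.toDBounded F.boundedToMinus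

instance : F.toDBounded.EssSurj where
  mem_essImage Y := by
    obtain ⟨X, ⟨e⟩⟩ := F.exists_toDMinus_iso Y
    exact ⟨X, ⟨F.boundedToMinus.preimageIso (F.toDBoundedIso.app X ≪≫ e)⟩⟩

end ExtSubbifunctor

theorem proposition3p9 {A : Type u} [Category.{v} A] [Abelian A] [HasExt.{w} A]
    (F : ExtSubbifunctor.{w} A) [F.EnoughProjectives] :
    -- the natural functor `K⁻(𝒫(F)) ⥤ D_F⁻(𝒜)` is a triangle equivalence
    (F.toDMinus.IsTriangulated ∧ F.toDMinus.IsEquivalence) ∧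
    -- and it induces a triangle equivalence between the subcategory of `K⁻(𝒫(F))` in which
    -- `Hom(P, -)`-cohomology vanishes in low degrees and `D_Fᵇ(𝒜)`
    ∃ (E : F.MinusHomBounded ⥤ F.DBounded) (_ : E.CommShift ℤ)
      (e : E ⋙ F.boundedToMinus ≅ F.homBounded.ι ⋙ F.toDMinus),
      NatTrans.CommShift e.hom ℤ ∧ E.IsTriangulated ∧ E.IsEquivalence :=
  ⟨⟨inferInstance, { }⟩, F.toDBounded, inferInstance, F.toDBoundedIso, inferInstance,
    inferInstance, { }⟩
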